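/- Let $G$ be a group. A virtual endomorphism of $G$ is a homomorphism $f:K\to G$ whose domain $K$ is a subgroup of finite index in $G$; it is recurrent if $f(K)=G$, and it is simple if the only subgroup $N\leq K$ that is normal in $G$ and satisfies $f(N)\leq N$ is the trivial subgroup. The group $G$ is called strongly recurrent self-similar if every subgroup $H$ of finite index in $G$ contains a subgroup $K$ of finite index for which there is a simple recurrent virtual endomorphism $f:K\to G$. The Malcev completion of a torsion-free nilpotent group $G$ is the torsion-free nilpotent group $G^{\ast}$, unique up to isomorphism, that contains $G$, in which every element has an $n$-th root for every $n\geq 1$, and in which every element has a positive power lying in $G$. **Theorem B.** Let $c\geq 0$ be an integer, and let $G_1$ and $G_2$ be finitely generated torsion-free nilpotent groups of class $c$ such that $G_1^{\ast}\cong G_2^{\ast}$. Then $G_1$ is strongly recurrent self-similar if and only if $G_2$ is strongly recurrent self-similar. -/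

import Mathlib

/-- A group is torsion-free if `1` is its only element of finite order. -/
def TorsionFreeGroup (G : Type*) [Group G] : Prop :=
  ∀ g : G, IsOfFinOrder g → g = 1

/-- `𝔗_c`-groups: finitely generated torsion-free nilpotent groups of nilpotency class (exactly)
`c`. Nilpotency is a separate field because `Group.nilpotencyClass` has the default value `0` on
groups that are not nilpotent. -/
structure IsTGroupOfClass (c : ℕ) (G : Type*) [Group G] : Prop where
  fg : Group.FG G
  torsionFree : TorsionFreeGroup G
  nilpotent : Group.IsNilpotent G
  nilpotencyClass_eq : Group.nilpotencyClass G = c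

/-- `ι : G →* M` exhibits `M` as the Malcev completion of the torsion-free nilpotent group `G`:
`M` is a torsion-free nilpotent group in which every element has an `n`-th root for every `n ≥ 1`
(a radicable group), `ι` is an embedding, and every element of `M` has a positive power in the
image of `G`. For a torsion-free nilpotent `G` these properties determine `(M, ι)` up to a unique
isomorphism. -/
structure IsMalcevCompletion {G M : Type*} [Group G] [Group M] (ι : G →* M) : Prop where
  nilpotent : Group.IsNilpotent M
  torsionFree : TorsionFreeGroup M
  radicable : ∀ n : ℕ, 0 < n → ∀ x : M, ∃ y : M, y ^ n = x
  injective : Function.Injective ι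
  exists_pow_mem : ∀ x : M, ∃ n : ℕ, 0 < n ∧ x ^ n ∈ ι.range

/-- A virtual endomorphism of a group `G`: a homomorphism to `G` from a subgroup of finite index
of `G`. -/
structure VirtualEndomorphism (G : Type*) [Group G] where
  domain : Subgroup G
  finiteIndex : domain.FiniteIndex
  toHom : domain →* G

namespace VirtualEndomorphism

variable {G : Type*} [Group G]

/-- The core of a virtual endomorphism `f`: the subgroup of `G` generated by all subgroups of the
domain of `f` that are normal in `G` and `f`-invariant. -/
def core (f : VirtualEndomorphism G) : Subgroup G :=
  sSup {N : Subgroup G | N ≤ f.domain ∧ N.Normal ∧ ∀ x : f.domain, (x : G) ∈ N → f.toHom x ∈ N}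

/-- A virtual endomorphism is simple if its core is trivial. -/
def IsSimple (f : VirtualEndomorphism G) : Prop :=
  f.core = ⊥

/-- A virtual endomorphism is recurrent if it is onto `G`. -/
def IsRecurrent (f : VirtualEndomorphism G) : Prop :=
  Function.Surjective f.toHom

end VirtualEndomorphism

/-- `G` is strongly recurrent self-similar if every subgroup `H` of finite index in `G` contains a
subgroup of finite index that is the domain of a simple recurrent virtual endomorphism of `G`.
(A subgroup of `H` has finite index in `H` if and only if it has finite index in `G`.) -/
def StronglyRecurrentSelfSimilar (G : Type*) [Group G] : Prop :=
  ∀ H : Subgroup G, H.FiniteIndex →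
    ∃ f : VirtualEndomorphism G, f.domain ≤ H ∧ f.IsSimple ∧ f.IsRecurrent

/-!
# Strong recurrent self-similarity depends only on the Malcev completion

After transporting along `M₁ ≃* M₂`, both groups are subgroups `A`, `B` of one torsion-free
radicable nilpotent group `M`, each containing a positive power of every element of `M`.

*Translation to automorphisms.* A simple recurrent virtual endomorphism `f` of `G` is injective:
`G` has unique roots, so the centre of the domain is central in `G`, and a nontrivial kernel would
meet it in a nontrivial subgroup lying in the core. Hence `f⁻¹` extends to an automorphism `φ` of
`M`: the isolator of the graph of `f⁻¹` in `M × M` is again a graph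
(`exists_mulEquiv_extending`). As nontrivial normal subgroups of nilpotent groups meet the centre,
`G` is strongly recurrent self-similar if and only if every finite index subgroup of `G` contains
`φ(G)` for an automorphism `φ` of `M` such that no nontrivial central subgroup `N ≤ G` satisfies
`φ⁻¹(N) ≤ N`. This is `HasSimpleContractions`.

*Change of lattice.* Let `L ≤ B` have finite index, and choose `m` with `b ^ m ∈ A` for all `b ∈ B`.
There is a finite index subgroup `H` of `L ⊓ A` such that `x ^ m ∈ H` implies `x ∈ L ⊓ A`
(`Subgroup.exists_finiteIndex_pow_mem_imp_mem`). If `φ(A) ≤ H`, then `φ(b) ^ m = φ(b ^ m) ∈ H`, so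
`φ(B) ≤ L`. If a central subgroup `N ≤ B` violates the condition on `φ` for `B`, then the subgroup
of its `m`-th powers violates it for `A`.

*Nilpotent groups.* The facts used are: the elements with a positive power in a given subgroup form
a subgroup (`Subgroup.isolator`), whence uniqueness of roots; a subgroup of a finitely generated
nilpotent group that contains a power of every element has finite index; and a finitely generated
nilpotent group has a finite index normal subgroup avoiding a given torsion subgroup, a form of
residual finiteness.
-/

open scoped commutatorElement

/-! ### Isolators and uniqueness of roots -/

theorem commutatorElement_pow_left {G : Type*} [Group G] {a x : G}
    (h : ⁅a, x⁆ ∈ Subgroup.center G) (n : ℕ) : ⁅a ^ n, x⁆ = ⁅a, x⁆ ^ n := by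
  have key : a * x * a⁻¹ = ⁅a, x⁆ * x := by simp [commutatorElement_def]
  have hc : Commute ⁅a, x⁆ x := (Subgroup.mem_center_iff.1 h x).symm
  have hconj : a ^ n * x * (a ^ n)⁻¹ = ⁅a, x⁆ ^ n * x := by
    induction n with
    | zero => simp
    | succ n ih =>
      have h1 := Subgroup.mem_center_iff.1 (pow_mem h n) a
      calc a ^ (n + 1) * x * (a ^ (n + 1))⁻¹ = a * (a ^ n * x * (a ^ n)⁻¹) * a⁻¹ := by
            rw [pow_succ']; group
        _ = (a * ⁅a, x⁆ ^ n) * x * a⁻¹ := by rw [ih]; group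
        _ = ⁅a, x⁆ ^ n * (a * x * a⁻¹) := by rw [h1]; group
        _ = ⁅a, x⁆ ^ (n + 1) * x := by rw [key, pow_succ, mul_assoc]
  rw [commutatorElement_def, hconj, mul_inv_cancel_right]

theorem commutatorElement_pow_pow {G : Type*} [Group G] {a x : G}
    (h : ⁅a, x⁆ ∈ Subgroup.center G) (m n : ℕ) : ⁅a ^ m, x ^ n⁆ = ⁅a, x⁆ ^ (m * n) := by
  have h' : ⁅x, a⁆ ∈ Subgroup.center G := by rw [← commutatorElement_inv]; exact inv_mem h
  have hx : ⁅a, x ^ n⁆ = ⁅a, x⁆ ^ n := by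
    rw [← commutatorElement_inv, commutatorElement_pow_left h', ← inv_pow, commutatorElement_inv]
  rw [commutatorElement_pow_left (hx ▸ pow_mem h n), hx, ← pow_mul, mul_comm]

theorem exists_pow_mem_of_exists_pow_mem_sup_center {G : Type*} [Group G] {K N : Subgroup G}
    (hN : N ≤ Subgroup.center G) (h : ∀ g : G, ∃ n, 0 < n ∧ g ^ n ∈ K ⊔ N)
    (hNK : ∀ u ∈ N, ∃ n, 0 < n ∧ u ^ n ∈ K) (g : G) : ∃ n, 0 < n ∧ g ^ n ∈ K := by
  have : N.Normal := ⟨fun u hu g => by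
    rwa [Subgroup.mem_center_iff.1 (hN hu) g, mul_inv_cancel_right]⟩
  obtain ⟨n, hn, hg⟩ := h g
  obtain ⟨k, hk, u, hu, hku⟩ := Subgroup.mem_sup_of_normal_right.1 hg
  obtain ⟨m, hm, hum⟩ := hNK u hu
  refine ⟨n * m, Nat.mul_pos hn hm, ?_⟩
  have hc : Commute k u := Subgroup.mem_center_iff.1 (hN hu) k
  rw [pow_mul, ← hku, hc.mul_pow]
  exact mul_mem (pow_mem hk m) hum

/-- The inductive step for `exists_pow_mem_of_closure_eq_top`. As `⁅A, ⊤⁆` is central, the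
commutator of `a ∈ A` and `x` is bimultiplicative and insensitive to central factors, so
`⁅a, x⁆ ^ (n * m) = ⁅a ^ n, x ^ m⁆` lies in `K` once `a ^ n` and `x ^ m` lie in `K ⊔ ⁅A, ⊤⁆`. -/
theorem exists_pow_mem_of_exists_pow_mem_sup_commutator {G : Type*} [Group G] {A K : Subgroup G}
    (hA : ⁅A, (⊤ : Subgroup G)⁆ ≤ Subgroup.center G)
    (h : ∀ g : G, ∃ n, 0 < n ∧ g ^ n ∈ K ⊔ ⁅A, (⊤ : Subgroup G)⁆) (g : G) :
    ∃ n, 0 < n ∧ g ^ n ∈ K := by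
  have hn : (⁅A, (⊤ : Subgroup G)⁆).Normal := ⟨fun u hu g => by
    rwa [Subgroup.mem_center_iff.1 (hA hu) g, mul_inv_cancel_right]⟩
  refine exists_pow_mem_of_exists_pow_mem_sup_center hA h (fun u hu => ?_) g
  have hu' := hu
  rw [Subgroup.commutator_def] at hu'
  induction hu' using Subgroup.closure_induction with
  | mem u hx =>
    obtain ⟨a, ha, x, -, rfl⟩ := hx
    obtain ⟨n, hn, hga⟩ := h a
    obtain ⟨m, hm, hgx⟩ := h x
    obtain ⟨k, hk, z, hz, hkz⟩ := Subgroup.mem_sup_of_normal_right.1 hga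
    obtain ⟨k', hk', z', hz', hkz'⟩ := Subgroup.mem_sup_of_normal_right.1 hgx
    refine ⟨n * m, Nat.mul_pos hn hm, ?_⟩
    rw [← commutatorElement_pow_pow (hA hu), ← hkz, ← hkz']
    have e1 := fun g => Subgroup.mem_center_iff.1 (hA hz) g
    have e2 := fun g => Subgroup.mem_center_iff.1 (hA hz') g
    have : ⁅k * z, k' * z'⁆ = ⁅k, k'⁆ := by
      have e3 : k * z * (k' * z') = k * k' * (z * z') := by
        rw [mul_assoc, ← mul_assoc z, ← e1 k']; group
      have e4 : k' * z' * (k * z) = k' * k * (z * z') := by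
        rw [mul_assoc, ← mul_assoc z', ← e2 k, ← e1 z']; group
      calc ⁅k * z, k' * z'⁆ = (k * z * (k' * z')) * (k' * z' * (k * z))⁻¹ := by
            rw [commutatorElement_def]; group
        _ = ⁅k, k'⁆ := by rw [e3, e4, commutatorElement_def]; group
    rw [this, commutatorElement_def]
    exact mul_mem (mul_mem (mul_mem hk hk') (inv_mem hk)) (inv_mem hk')
  | one => exact ⟨1, one_pos, by simp⟩
  | mul u v hu1 hv1 ihu ihv =>
    rw [← Subgroup.commutator_def] at hu1 hv1
    obtain ⟨n, hn, hun⟩ := ihu hu1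
    obtain ⟨m, hm, hvm⟩ := ihv hv1
    refine ⟨n * m, Nat.mul_pos hn hm, ?_⟩
    have hc : Commute u v := Subgroup.mem_center_iff.1 (hA hv1) u
    rw [hc.mul_pow, pow_mul, mul_comm n m, pow_mul v]
    exact mul_mem (pow_mem hun m) (pow_mem hvm n)
  | inv u hu1 ihu =>
    rw [← Subgroup.commutator_def] at hu1
    obtain ⟨n, hn, hun⟩ := ihu hu1
    exact ⟨n, hn, by rw [inv_pow]; exact inv_mem hun⟩

/-- If a nilpotent group is generated by elements having a positive power in `K`, then all its
elements do. One climbs down the lower central series: powers in `K` times the `i`-th term are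
improved to powers in `K` times the next term. -/
theorem exists_pow_mem_of_closure_eq_top {G : Type*} [Group G] [Group.IsNilpotent G]
    {K : Subgroup G} {S : Set G} (hS : Subgroup.closure S = ⊤)
    (h : ∀ s ∈ S, ∃ n, 0 < n ∧ s ^ n ∈ K) (g : G) : ∃ n, 0 < n ∧ g ^ n ∈ K := by
  suffices H : ∀ i (g : G), ∃ n, 0 < n ∧ g ^ n ∈ K ⊔ (⊤ : Subgroup G).lowerCentralSeries i by
    obtain ⟨c, hc⟩ := Subgroup.nilpotent_iff_lowerCentralSeries.1 ‹Group.IsNilpotent G›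
    simpa [hc] using H c g
  intro i
  induction i with
  | zero => exact fun g => ⟨1, one_pos, by simp⟩
  | succ i ih =>
    set L := (⊤ : Subgroup G).lowerCentralSeries (i + 1) with hL
    let π := QuotientGroup.mk' L
    have hπ : Function.Surjective π := QuotientGroup.mk'_surjective L
    -- It suffices to find powers in the image of `K` in `G ⧸ L`.
    suffices H : ∀ q : G ⧸ L, ∃ n, 0 < n ∧ q ^ n ∈ K.map π by
      intro g
      obtain ⟨n, hn, hg⟩ := H (π g)
      refine ⟨n, hn, ?_⟩
      rw [← map_pow, ← Subgroup.mem_comap, Subgroup.comap_map_eq, QuotientGroup.ker_mk'] at hg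
      exact hg
    have hcomm : ∀ a ∈ (⊤ : Subgroup G).lowerCentralSeries i, ∀ x : G, Commute (π x) (π a) := by
      intro a ha x
      have : ⁅a, x⁆ ∈ L := by
        rw [hL, Subgroup.lowerCentralSeries_succ]
        exact Subgroup.commutator_mem_commutator ha (Subgroup.mem_top x)
      have h1 : π ⁅a, x⁆ = 1 := (QuotientGroup.eq_one_iff _).2 this
      rw [map_commutatorElement, commutatorElement_eq_one_iff_commute] at h1
      exact h1.symm
    have hcenter : ((⊤ : Subgroup G).lowerCentralSeries i).map π ≤ Subgroup.center (G ⧸ L) := by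
      rintro _ ⟨a, ha, rfl⟩
      refine Subgroup.mem_center_iff.2 fun q => ?_
      obtain ⟨x, rfl⟩ := hπ q
      exact hcomm a ha x
    rcases i with - | i
    -- In the abelian quotient the claim passes from the generators to all products.
    · have hab : ∀ p q : G ⧸ L, Commute p q := by
        intro p q
        obtain ⟨x, rfl⟩ := hπ p
        obtain ⟨y, rfl⟩ := hπ q
        exact hcomm y (Subgroup.mem_top y) x
      intro q
      obtain ⟨x, rfl⟩ := hπ q
      have hx : x ∈ Subgroup.closure S := hS ▸ Subgroup.mem_top x
      induction hx using Subgroup.closure_induction with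
      | mem s hs =>
        obtain ⟨n, hn, hsn⟩ := h s hs
        exact ⟨n, hn, by rw [← map_pow]; exact Subgroup.mem_map_of_mem π hsn⟩
      | one => exact ⟨1, one_pos, by simp⟩
      | mul u v _ _ ihu ihv =>
        obtain ⟨n, hn, hun⟩ := ihu
        obtain ⟨m, hm, hvm⟩ := ihv
        refine ⟨n * m, Nat.mul_pos hn hm, ?_⟩
        rw [map_mul, (hab _ _).mul_pow, pow_mul, mul_comm n m, pow_mul (π v)]
        exact mul_mem (pow_mem hun m) (pow_mem hvm n)
      | inv u _ ihu =>
        obtain ⟨n, hn, hun⟩ := ihu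
        exact ⟨n, hn, by rw [map_inv, inv_pow]; exact inv_mem hun⟩
    · have e : ((⊤ : Subgroup G).lowerCentralSeries (i + 1)).map π =
          ⁅((⊤ : Subgroup G).lowerCentralSeries i).map π, (⊤ : Subgroup (G ⧸ L))⁆ := by
        rw [Subgroup.lowerCentralSeries_succ, Subgroup.map_commutator,
          Subgroup.map_top_of_surjective π hπ]
      rw [e] at hcenter
      refine exists_pow_mem_of_exists_pow_mem_sup_commutator hcenter fun q => ?_
      obtain ⟨x, rfl⟩ := hπ q
      obtain ⟨n, hn, hx⟩ := ih x
      refine ⟨n, hn, ?_⟩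
      rw [← e, ← Subgroup.map_sup, ← map_pow]
      exact Subgroup.mem_map_of_mem π hx

/-- The isolator of a subgroup `K` of a nilpotent group: the elements with a positive power in
`K`. -/
def Subgroup.isolator {G : Type*} [Group G] [Group.IsNilpotent G] (K : Subgroup G) :
    Subgroup G where
  carrier := {g | ∃ n, 0 < n ∧ g ^ n ∈ K}
  one_mem' := ⟨1, one_pos, by simp⟩
  inv_mem' := by
    rintro g ⟨n, hn, hg⟩
    exact ⟨n, hn, by rw [inv_pow]; exact inv_mem hg⟩
  mul_mem' := by
    intro x y hx hy
    set S : Set G := {g | ∃ n, 0 < n ∧ g ^ n ∈ K}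
    have hxy : x * y ∈ Subgroup.closure S :=
      mul_mem (Subgroup.subset_closure hx) (Subgroup.subset_closure hy)
    obtain ⟨n, hn, h⟩ := exists_pow_mem_of_closure_eq_top
      (K := K.subgroupOf (Subgroup.closure S)) (Subgroup.closure_closure_coe_preimage (k := S))
      (fun s hs => by
        obtain ⟨n, hn, h⟩ := hs
        exact ⟨n, hn, h⟩) ⟨x * y, hxy⟩
    exact ⟨n, hn, h⟩

theorem Subgroup.mem_isolator {G : Type*} [Group G] [Group.IsNilpotent G] {K : Subgroup G}
    {g : G} : g ∈ K.isolator ↔ ∃ n, 0 < n ∧ g ^ n ∈ K := Iff.rfl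

/-- Torsion-free nilpotent groups have unique roots. If `x ^ n = y ^ n`, then `(x, y)` and `(y, y)`
lie in the isolator of the diagonal of `G × G`, hence so does `(x / y, 1)`, and `x / y` has finite
order. -/
theorem TorsionFreeGroup.isMulTorsionFree {G : Type*} [Group G] [Group.IsNilpotent G]
    (hG : TorsionFreeGroup G) : IsMulTorsionFree G where
  pow_left_injective n hn x y hxy := by
    let Δ : Subgroup (G × G) := ((MonoidHom.id G).prod (MonoidHom.id G)).range
    have h1 : (x, y) ∈ Δ.isolator := ⟨n, Nat.pos_of_ne_zero hn, x ^ n, by simpa using hxy⟩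
    have h2 : (y, y) ∈ Δ.isolator := ⟨1, one_pos, y, by simp⟩
    obtain ⟨k, hk, z, hz⟩ := div_mem h1 h2
    have hz' : z = (x / y) ^ k ∧ z = 1 := by simpa [Prod.ext_iff] using hz
    refine div_eq_one.1 (hG _ (isOfFinOrder_iff_pow_eq_one.2 ⟨k, hk, ?_⟩))
    rw [← hz'.1, hz'.2]

/-! ### Finite index subgroups of finitely generated nilpotent groups -/

/-- By induction on the nilpotency class, `P = K ⊔ Z(G)` has finite index, so it is finitely
generated by Schreier's lemma. It normalizes `K`, and `P ⧸ K` is a finitely generated abelian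
torsion group, hence finite. -/
theorem Subgroup.index_ne_zero_of_forall_exists_pow_mem {G : Type*} [Group G]
    [Group.IsNilpotent G] [Group.FG G] {K : Subgroup G} (h : ∀ g : G, ∃ n, 0 < n ∧ g ^ n ∈ K) :
    K.index ≠ 0 := by
  suffices H : ∀ [Group.FG G] (K : Subgroup G), (∀ g : G, ∃ n, 0 < n ∧ g ^ n ∈ K) →
      K.index ≠ 0 from H K h
  refine Group.nilpotent_center_quotient_ind (P := fun G _ _ => ∀ [Group.FG G] (K : Subgroup G),
    (∀ g : G, ∃ n, 0 < n ∧ g ^ n ∈ K) → K.index ≠ 0) G ?_ ?_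
  · intro G _ _ _ K _
    exact Subgroup.FiniteIndex.index_ne_zero
  · intro G _ _ ih _ K h
    let π := QuotientGroup.mk' (Subgroup.center G)
    have hπ : Function.Surjective π := QuotientGroup.mk'_surjective _
    have hP : (K ⊔ Subgroup.center G).index ≠ 0 := by
      have h1 := ih (K.map π) fun q => by
        obtain ⟨g, rfl⟩ := hπ q
        obtain ⟨n, hn, hg⟩ := h g
        exact ⟨n, hn, by rw [← map_pow]; exact Subgroup.mem_map_of_mem π hg⟩
      rwa [← Subgroup.index_comap_of_surjective _ hπ, Subgroup.comap_map_eq,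
        QuotientGroup.ker_mk'] at h1
    set P := K ⊔ Subgroup.center G with hPdef
    have : P.FiniteIndex := ⟨hP⟩
    have hfact : ∀ p : P, ∃ k ∈ K, ∃ z ∈ Subgroup.center G, k * z = p := fun p =>
      Subgroup.mem_sup_of_normal_right.1 p.2
    have hnormal : (K.subgroupOf P).Normal := by
      refine ⟨fun x hx p => ?_⟩
      obtain ⟨k, hk, z, hz, hkz⟩ := hfact p
      have : ((p * x * p⁻¹ : P) : G) = k * x * k⁻¹ := by
        have e := Subgroup.mem_center_iff.1 hz x
        calc ((p * x * p⁻¹ : P) : G) = k * (z * x) * z⁻¹ * k⁻¹ := by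
              simp [← hkz, mul_assoc]
          _ = k * x * k⁻¹ := by rw [← e]; group
      rw [Subgroup.mem_subgroupOf, this]
      exact mul_mem (mul_mem hk hx) (inv_mem hk)
    -- Every coset in `P ⧸ K` has a central representative, so the quotient is abelian.
    have hrep : ∀ q : P ⧸ K.subgroupOf P,
        ∃ z : P, (z : G) ∈ Subgroup.center G ∧ (z : P ⧸ _) = q := by
      intro q
      obtain ⟨p, rfl⟩ := QuotientGroup.mk_surjective q
      obtain ⟨k, hk, z, hz, hkz⟩ := hfact p
      refine ⟨⟨z, Subgroup.mem_sup_right hz⟩, hz, ?_⟩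
      rw [eq_comm, QuotientGroup.eq_iff_div_mem, Subgroup.mem_subgroupOf]
      simpa [← hkz] using hk
    let _ : CommGroup (P ⧸ K.subgroupOf P) :=
      { (inferInstance : Group (P ⧸ K.subgroupOf P)) with
        mul_comm := by
          intro a b
          obtain ⟨z, hz, rfl⟩ := hrep a
          obtain ⟨w, -, rfl⟩ := hrep b
          rw [← QuotientGroup.mk_mul, ← QuotientGroup.mk_mul]
          congr 1
          exact Subtype.ext (Subgroup.mem_center_iff.1 hz w).symm }
    have htor : IsMulTorsion (P ⧸ K.subgroupOf P) := by
      intro q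
      obtain ⟨p, rfl⟩ := QuotientGroup.mk_surjective q
      obtain ⟨n, hn, hp⟩ := h p
      refine isOfFinOrder_iff_pow_eq_one.2 ⟨n, hn, ?_⟩
      rw [← QuotientGroup.mk_pow, QuotientGroup.eq_one_iff, Subgroup.mem_subgroupOf]
      simpa using hp
    have hfin : Finite (P ⧸ K.subgroupOf P) := CommGroup.finite_of_fg_isMulTorsion _ htor
    have hrel : K.relIndex P ≠ 0 := by
      have : (K.subgroupOf P).FiniteIndex := Subgroup.finiteIndex_of_finite_quotient
      exact this.index_ne_zero
    rw [← Subgroup.relIndex_mul_index (le_sup_left : K ≤ P)]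
    exact mul_ne_zero hrel hP

theorem Subgroup.relIndex_ne_zero_of_forall_exists_pow_mem {G : Type*} [Group G]
    [Group.IsNilpotent G] {K L : Subgroup G} (hL : L.FG)
    (h : ∀ g ∈ L, ∃ n, 0 < n ∧ g ^ n ∈ K) : K.relIndex L ≠ 0 := by
  have : Group.FG L := (Group.fg_iff_subgroup_fg L).2 hL
  exact Subgroup.index_ne_zero_of_forall_exists_pow_mem fun g => h g g.2

theorem Subgroup.FG.map {G H : Type*} [Group G] [Group H] {K : Subgroup G} (hK : K.FG)
    (f : G →* H) : (K.map f).FG := by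
  obtain ⟨S, rfl, hS⟩ := (Subgroup.fg_iff K).1 hK
  exact (Subgroup.fg_iff _).2 ⟨f '' S, (MonoidHom.map_closure f S).symm, hS.image f⟩

theorem Subgroup.FG.of_relIndex_ne_zero {G : Type*} [Group G] {K L : Subgroup G} (hL : L.FG)
    (hKL : K ≤ L) (h : K.relIndex L ≠ 0) : K.FG := by
  have : Group.FG L := (Group.fg_iff_subgroup_fg L).2 hL
  have : (K.subgroupOf L).FiniteIndex := ⟨h⟩
  have h1 : (K.subgroupOf L).FG := (Group.fg_iff_subgroup_fg _).1 inferInstance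
  have h2 := Subgroup.FG.map h1 L.subtype
  rwa [Subgroup.subgroupOf_map_subtype, inf_eq_left.2 hKL] at h2

theorem Subgroup.exists_forall_pow_mem_of_relIndex_ne_zero {G : Type*} [Group G]
    {K L : Subgroup G} (h : K.relIndex L ≠ 0) : ∃ m, 0 < m ∧ ∀ g ∈ L, g ^ m ∈ K :=
  ⟨(K.relIndex L).factorial, Nat.factorial_pos _, fun _ hg =>
    (Subgroup.pow_mem_of_relIndex_ne_zero_of_dvd h hg fun _ hk hk' => Nat.dvd_factorial hk hk').1⟩

/-! ### Residual finiteness relative to a torsion subgroup -/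

/-- A finitely generated nilpotent group with torsion centre is a torsion group. If `x` is central
modulo the centre, the commutators of `x` with finitely many generators have a common exponent `e`,
and `x ^ e` is central; so `G ⧸ Z(G)` has torsion centre as well, and one inducts on the class. -/
theorem isMulTorsion_of_center {G : Type*} [Group G] [Group.IsNilpotent G] [Group.FG G]
    (h : ∀ z ∈ Subgroup.center G, IsOfFinOrder z) : IsMulTorsion G := by
  suffices H : ∀ [Group.FG G], (∀ z ∈ Subgroup.center G, IsOfFinOrder z) → IsMulTorsion G from H h
  refine Group.nilpotent_center_quotient_ind (P := fun G _ _ => ∀ [Group.FG G],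
    (∀ z ∈ Subgroup.center G, IsOfFinOrder z) → IsMulTorsion G) G ?_ ?_
  · intro G _ _ _ _ g
    rw [Subsingleton.elim g 1]
    exact IsOfFinOrder.one
  · intro G _ _ ih _ h
    obtain ⟨S, hS⟩ := Group.fg_def.1 ‹Group.FG G›
    have hquot : ∀ q ∈ Subgroup.center (G ⧸ Subgroup.center G), IsOfFinOrder q := by
      intro q hq
      obtain ⟨x, rfl⟩ := QuotientGroup.mk_surjective q
      have hx : ∀ y : G, ⁅x, y⁆ ∈ Subgroup.center G := by
        intro y
        rw [← QuotientGroup.eq_one_iff, ← QuotientGroup.mk'_apply, map_commutatorElement,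
          commutatorElement_eq_one_iff_commute]
        exact (Subgroup.mem_center_iff.1 hq _).symm
      have he : 0 < ∏ y ∈ S, orderOf ⁅x, y⁆ :=
        Finset.prod_pos fun y _ => (h _ (hx y)).orderOf_pos
      refine isOfFinOrder_iff_pow_eq_one.2 ⟨_, he, ?_⟩
      rw [← QuotientGroup.mk_pow, QuotientGroup.eq_one_iff, ← Subgroup.centralizer_univ,
        ← Subgroup.coe_top, ← hS, Subgroup.centralizer_closure, Subgroup.mem_centralizer_iff]
      intro y hy
      have : ⁅x ^ ∏ y ∈ S, orderOf ⁅x, y⁆, y⁆ = 1 := by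
        rw [commutatorElement_pow_left (hx y), ← orderOf_dvd_iff_pow_eq_one]
        exact Finset.dvd_prod_of_mem (fun y => orderOf ⁅x, y⁆) hy
      exact (commutatorElement_eq_one_iff_mul_comm.1 this).symm
    intro g
    obtain ⟨n, hn, hg⟩ := isOfFinOrder_iff_pow_eq_one.1 (ih hquot (g : G ⧸ Subgroup.center G))
    rw [← QuotientGroup.mk_pow, QuotientGroup.eq_one_iff] at hg
    exact (isOfFinOrder_pow.1 (h _ hg)).resolve_right hn.ne'

/-- A form of residual finiteness: in a finitely generated nilpotent group, some normal subgroup of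
finite index meets a given torsion subgroup `F` trivially. Take `T` maximal among the normal
subgroups meeting `F` trivially. Every nontrivial normal subgroup of `G ⧸ T` meets the image of `F`,
so `G ⧸ T` has torsion centre. It is then a torsion group, hence finite. -/
theorem Subgroup.exists_normal_finiteIndex_inf_eq_bot {G : Type*} [Group G] [Group.IsNilpotent G]
    [Group.FG G] {F : Subgroup G} (hF : ∀ x ∈ F, IsOfFinOrder x) :
    ∃ T : Subgroup G, T.Normal ∧ T.index ≠ 0 ∧ T ⊓ F = ⊥ := by
  obtain ⟨T, -, hT⟩ := zorn_le_nonempty₀ {T : Subgroup G | T.Normal ∧ T ⊓ F = ⊥}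
    (fun c hc hchain T₀ hT₀ => by
      have hmem : ∀ {x}, x ∈ sSup c ↔ ∃ T ∈ c, x ∈ T :=
        Subgroup.mem_sSup_of_directedOn ⟨T₀, hT₀⟩ hchain.directedOn
      refine ⟨sSup c, ⟨⟨fun x hx g => ?_⟩, ?_⟩, fun T hT => le_sSup hT⟩
      · obtain ⟨T, hT, hxT⟩ := hmem.1 hx
        exact hmem.2 ⟨T, hT, (hc hT).1.conj_mem x hxT g⟩
      · refine (Subgroup.eq_bot_iff_forall _).2 fun x hx => ?_
        obtain ⟨T, hT, hxT⟩ := hmem.1 hx.1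
        exact (Subgroup.eq_bot_iff_forall _).1 (hc hT).2 x ⟨hxT, hx.2⟩)
    ⊥ ⟨inferInstance, bot_inf_eq _⟩
  have hTn : T.Normal := hT.prop.1
  let π := QuotientGroup.mk' T
  have hπ : Function.Surjective π := QuotientGroup.mk'_surjective _
  have htor : IsMulTorsion (G ⧸ T) := by
    refine isMulTorsion_of_center fun z hz => ?_
    by_contra hz'
    have hZn : (Subgroup.zpowers z).Normal := ⟨fun x hx g => by
      rwa [Subgroup.mem_center_iff.1 (Subgroup.zpowers_le.2 hz hx) g, mul_inv_cancel_right]⟩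
    have hle : T ≤ (Subgroup.zpowers z).comap π := by
      intro t ht
      have : π t = 1 := (QuotientGroup.eq_one_iff t).2 ht
      rw [Subgroup.mem_comap, this]
      exact one_mem _
    have hbot : (Subgroup.zpowers z).comap π ⊓ F = ⊥ := by
      refine (Subgroup.eq_bot_iff_forall _).2 fun y hy => ?_
      obtain ⟨j, hj⟩ := Subgroup.mem_zpowers_iff.1 hy.1
      obtain ⟨e, he, hye⟩ := isOfFinOrder_iff_pow_eq_one.1 (hF y hy.2)
      have h1 : z ^ (j * e) = 1 := by
        rw [zpow_mul, hj, zpow_natCast, ← map_pow, hye, map_one]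
      have hj0 : j = 0 := by
        by_contra hj0
        exact hz' (isOfFinOrder_iff_zpow_eq_one.2
          ⟨j * e, mul_ne_zero hj0 (by exact_mod_cast he.ne'), h1⟩)
      have hyT : y ∈ T := by
        rw [← QuotientGroup.eq_one_iff]
        change π y = 1
        rw [← hj, hj0, zpow_zero]
      exact (Subgroup.eq_bot_iff_forall _).1 hT.prop.2 y ⟨hyT, hy.2⟩
    -- By maximality of `T`, the element `z` is trivial in `G ⧸ T`, against its infinite order.
    have hle' := hT.le_of_ge ⟨inferInstance, hbot⟩ hle
    obtain ⟨t, rfl⟩ := hπ z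
    have ht : t ∈ T := hle' (Subgroup.mem_zpowers _)
    refine hz' ?_
    rw [show π t = 1 from (QuotientGroup.eq_one_iff t).2 ht]
    exact IsOfFinOrder.one
  refine ⟨T, hTn, ?_, hT.prop.2⟩
  have h1 : (⊥ : Subgroup (G ⧸ T)).index ≠ 0 :=
    Subgroup.index_ne_zero_of_forall_exists_pow_mem fun q => by
      simpa using isOfFinOrder_iff_pow_eq_one.1 (htor q)
  rwa [← Subgroup.index_comap_of_surjective _ hπ, MonoidHom.comap_bot,
    QuotientGroup.ker_mk'] at h1

/-! ### Finite index subgroups whose roots stay in a given subgroup -/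

theorem mem_center_of_pow_mem_center {M : Type*} [Group M] [IsMulTorsionFree M] {n : ℕ}
    (hn : n ≠ 0) {x : M} (h : x ^ n ∈ Subgroup.center M) : x ∈ Subgroup.center M := by
  refine Subgroup.mem_center_iff.2 fun g => ?_
  have h1 : (g * x * g⁻¹) ^ n = x ^ n := by
    rw [conj_pow, Subgroup.mem_center_iff.1 h g, mul_inv_cancel_right]
  exact mul_inv_eq_iff_eq_mul.1 (pow_left_injective hn h1)

theorem isMulTorsionFree_quotient_center {M : Type*} [Group M] [Group.IsNilpotent M]
    [IsMulTorsionFree M] : IsMulTorsionFree (M ⧸ Subgroup.center M) := by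
  refine TorsionFreeGroup.isMulTorsionFree fun q hq => ?_
  obtain ⟨x, rfl⟩ := QuotientGroup.mk_surjective q
  obtain ⟨n, hn, hx⟩ := isOfFinOrder_iff_pow_eq_one.1 hq
  rw [← QuotientGroup.mk_pow, QuotientGroup.eq_one_iff] at hx
  exact (QuotientGroup.eq_one_iff x).2 (mem_center_of_pow_mem_center hn.ne' hx)

/-- `L` has a subgroup `U` of finite index such that every element of `U ⊓ Z(M)` is an `m`-th power
in `L ⊓ Z(M)`. This is residual finiteness of the quotient of `L` by the subgroup of `m`-th powers
of `L ⊓ Z(M)`, relative to the image of `L ⊓ Z(M)`, which has exponent dividing `m`. -/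
theorem Subgroup.exists_finiteIndex_inf_center_le_pow {M : Type*} [Group M] [Group.IsNilpotent M]
    {L : Subgroup M} (hL : L.FG) {m : ℕ} (hm : 0 < m) :
    ∃ U ≤ L, U.relIndex L ≠ 0 ∧
      ∀ z ∈ U, z ∈ Subgroup.center M → ∃ w ∈ L, w ∈ Subgroup.center M ∧ w ^ m = z := by
  have : Group.FG L := (Group.fg_iff_subgroup_fg L).2 hL
  -- `W` consists of the `m`-th powers of the elements of `L ⊓ Z(M)`.
  let W : Subgroup L :=
    { carrier := {z | ∃ w ∈ L, w ∈ Subgroup.center M ∧ w ^ m = z}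
      one_mem' := ⟨1, one_mem _, one_mem _, by simp⟩
      mul_mem' := by
        rintro _ _ ⟨v, hv, hvc, hv'⟩ ⟨w, hw, hwc, hw'⟩
        refine ⟨v * w, mul_mem hv hw, mul_mem hvc hwc, ?_⟩
        rw [(show Commute v w from Subgroup.mem_center_iff.1 hwc v).mul_pow, hv', hw',
          Subgroup.coe_mul]
      inv_mem' := by
        rintro _ ⟨v, hv, hvc, hv'⟩
        exact ⟨v⁻¹, inv_mem hv, inv_mem hvc, by rw [inv_pow, hv', Subgroup.coe_inv]⟩ }
  have hW : ∀ z : L, z ∈ W ↔ ∃ w ∈ L, w ∈ Subgroup.center M ∧ w ^ m = z := fun z => Iff.rfl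
  have hWn : W.Normal := by
    refine ⟨fun x hx g => ?_⟩
    obtain ⟨w, hw, hwc, hwx⟩ := (hW x).1 hx
    have hxc : (x : M) ∈ Subgroup.center M := hwx ▸ pow_mem hwc m
    have : g * x * g⁻¹ = x := by
      rw [mul_inv_eq_iff_eq_mul]
      exact Subtype.ext (Subgroup.mem_center_iff.1 hxc g)
    rwa [this]
  obtain ⟨T, hTn, hT, hTF⟩ := Subgroup.exists_normal_finiteIndex_inf_eq_bot
    (F := ((Subgroup.center M).subgroupOf L).map (QuotientGroup.mk' W)) (by
      rintro _ ⟨x, hx, rfl⟩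
      refine isOfFinOrder_iff_pow_eq_one.2 ⟨m, hm, ?_⟩
      rw [← map_pow]
      exact (QuotientGroup.eq_one_iff _).2 ((hW _).2 ⟨x, x.2, hx, by simp⟩))
  refine ⟨(T.comap (QuotientGroup.mk' W)).map L.subtype, Subgroup.map_subtype_le _, ?_, ?_⟩
  · rwa [Subgroup.relIndex, Subgroup.subgroupOf,
      Subgroup.comap_map_eq_self_of_injective L.subtype_injective,
      Subgroup.index_comap_of_surjective _ (QuotientGroup.mk'_surjective W)]
  · rintro _ ⟨z, hz, rfl⟩ hzc
    refine (hW z).1 ((QuotientGroup.eq_one_iff z).1 ?_)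
    exact (Subgroup.eq_bot_iff_forall _).1 hTF _ ⟨hz, z, hzc, rfl⟩

/-- `L` has a subgroup `H` of finite index all of whose `m`-th roots in `M` lie in `L`. The proof is
by induction on the class of `M`: a subgroup `U` of `L` whose central elements are `m`-th powers of
central elements of `L` is used to correct a root that lies in `L` only modulo the centre. -/
theorem Subgroup.exists_finiteIndex_pow_mem_imp_mem {M : Type*} [Group M] [Group.IsNilpotent M]
    [IsMulTorsionFree M] {L : Subgroup M} (hL : L.FG) {m : ℕ} (hm : 0 < m) :
    ∃ H ≤ L, H.relIndex L ≠ 0 ∧ ∀ x, x ^ m ∈ H → x ∈ L := by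
  suffices H : ∀ [IsMulTorsionFree M] (L : Subgroup M), L.FG →
      ∃ H ≤ L, H.relIndex L ≠ 0 ∧ ∀ x, x ^ m ∈ H → x ∈ L from H L hL
  refine Group.nilpotent_center_quotient_ind (P := fun M _ _ => ∀ [IsMulTorsionFree M]
    (L : Subgroup M), L.FG → ∃ H ≤ L, H.relIndex L ≠ 0 ∧ ∀ x, x ^ m ∈ H → x ∈ L) M ?_ ?_
  · intro M _ _ _ L _
    exact ⟨L, le_rfl, by simp, fun x _ => Subsingleton.elim 1 x ▸ one_mem L⟩
  · intro M _ _ ih _ L hL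
    have : IsMulTorsionFree (M ⧸ Subgroup.center M) := isMulTorsionFree_quotient_center
    obtain ⟨U, hUL, hU, hUc⟩ := Subgroup.exists_finiteIndex_inf_center_le_pow hL hm
    let π := QuotientGroup.mk' (Subgroup.center M)
    obtain ⟨H, -, hH, hHU⟩ := ih (U.map π) ((hL.of_relIndex_ne_zero hUL hU).map π)
    refine ⟨U ⊓ H.comap π, inf_le_left.trans hUL, ?_, fun x hx => ?_⟩
    · refine Subgroup.relIndex_ne_zero_trans (K := U) ?_ hU
      rwa [Subgroup.inf_relIndex_left, Subgroup.relIndex_comap]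
    · have h1 : π x ^ m ∈ H := by rw [← map_pow]; exact hx.2
      obtain ⟨u, hu, hux⟩ := hHU _ h1
      have hz : u⁻¹ * x ∈ Subgroup.center M := QuotientGroup.eq.1 hux
      set z := u⁻¹ * x
      have hxz : x = u * z := by simp [z]
      -- `x = u * z` with `z` central, so `z ^ m = u ^ (-m) * x ^ m` is a central element of `U`.
      -- It has an `m`-th root in `L`, which is `z` by uniqueness of roots.
      have hzm : z ^ m ∈ U := by
        have e : x ^ m = u ^ m * z ^ m := by
          rw [hxz, (show Commute u z from Subgroup.mem_center_iff.1 hz u).mul_pow]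
        have := mul_mem (inv_mem (pow_mem hu m)) hx.1
        rwa [e, inv_mul_cancel_left] at this
      obtain ⟨w, hw, -, hwz⟩ := hUc _ hzm (pow_mem hz m)
      rw [hxz, ← pow_left_injective hm.ne' hwz]
      exact mul_mem (hUL hu) hw

/-! ### Normal subgroups and the centre -/

theorem Subgroup.exists_mem_center_of_normal_ne_bot {G : Type*} [Group G] [Group.IsNilpotent G]
    {N : Subgroup G} [hN : N.Normal] (h : N ≠ ⊥) : ∃ x ∈ N, x ∈ Subgroup.center G ∧ x ≠ 1 := by
  suffices H : ∀ k, ∀ x ∈ N, x ≠ 1 → x ∈ Subgroup.upperCentralSeries G k →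
      ∃ x ∈ N, x ∈ Subgroup.center G ∧ x ≠ 1 by
    obtain ⟨x, hx, hx1⟩ := N.bot_or_exists_ne_one.resolve_left h
    obtain ⟨c, hc⟩ := Group.IsNilpotent.nilpotent G
    exact H c x hx hx1 (hc ▸ Subgroup.mem_top _)
  intro k
  induction k with
  | zero => exact fun x _ hx1 hx0 => absurd (Subgroup.mem_bot.1 hx0) hx1
  | succ k ih =>
    intro x hx hx1 hxk
    by_cases hc : ∀ y : G, ⁅x, y⁆ = 1
    · exact ⟨x, hx, Subgroup.mem_center_iff.2 fun y =>
        (commutatorElement_eq_one_iff_mul_comm.1 (hc y)).symm, hx1⟩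
    · push Not at hc
      obtain ⟨y, hy⟩ := hc
      refine ih ⁅x, y⁆ ?_ hy (Subgroup.mem_upperCentralSeries_succ_iff.1 hxk y)
      rw [commutatorElement_def, mul_assoc, mul_assoc, ← mul_assoc y]
      exact mul_mem hx (hN.conj_mem _ (inv_mem hx) y)

/-! ### Extension of homomorphisms to a radicable group -/

/-- Two embeddings of `K` in a torsion-free radicable nilpotent group `M`, each with a positive
power of every element of `M` in its range, differ by an automorphism of `M`. Its graph is the isolator in
`M × M` of the range of `(α, β)`. -/
theorem exists_mulEquiv_extending {K M : Type*} [Group K] [Group M] [Group.IsNilpotent M]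
    [IsMulTorsionFree M] (hrad : ∀ n : ℕ, 0 < n → ∀ x : M, ∃ y : M, y ^ n = x) {α β : K →* M}
    (hα : Function.Injective α) (hβ : Function.Injective β)
    (hα' : ∀ x, ∃ n, 0 < n ∧ x ^ n ∈ α.range) (hβ' : ∀ x, ∃ n, 0 < n ∧ x ^ n ∈ β.range) :
    ∃ φ : M ≃* M, ∀ k, φ (α k) = β k := by
  -- Uniqueness of roots makes both projections of the isolator `Γ` injective, and existence of
  -- roots makes them surjective.
  let Γ : Subgroup (M × M) := (α.prod β).range.isolator
  have hΓ : ∀ p : M × M, p ∈ Γ ↔ ∃ n, 0 < n ∧ ∃ k, α k = p.1 ^ n ∧ β k = p.2 ^ n := by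
    intro p
    simp [Γ, Subgroup.mem_isolator, Prod.ext_iff]
  let p₁ : Γ →* M := (MonoidHom.fst M M).comp Γ.subtype
  let p₂ : Γ →* M := (MonoidHom.snd M M).comp Γ.subtype
  have h₁ : Function.Bijective p₁ := by
    refine ⟨(injective_iff_map_eq_one _).2 ?_, fun x => ?_⟩
    · rintro ⟨⟨x, y⟩, hxy⟩ (rfl : x = 1)
      obtain ⟨n, hn, k, hk, hk'⟩ := (hΓ _).1 hxy
      have hk1 : k = 1 := hα (by simpa using hk)
      have hy : y ^ n = 1 ^ n := by simpa [hk1] using hk'.symm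
      simp [pow_left_injective hn.ne' hy]
    · obtain ⟨n, hn, k, hk⟩ := hα' x
      obtain ⟨y, hy⟩ := hrad n hn (β k)
      exact ⟨⟨(x, y), (hΓ _).2 ⟨n, hn, k, hk, hy.symm⟩⟩, rfl⟩
  have h₂ : Function.Bijective p₂ := by
    refine ⟨(injective_iff_map_eq_one _).2 ?_, fun y => ?_⟩
    · rintro ⟨⟨x, y⟩, hxy⟩ (rfl : y = 1)
      obtain ⟨n, hn, k, hk, hk'⟩ := (hΓ _).1 hxy
      have hk1 : k = 1 := hβ (by simpa using hk')
      have hx : x ^ n = 1 ^ n := by simpa [hk1] using hk.symm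
      simp [pow_left_injective hn.ne' hx]
    · obtain ⟨n, hn, k, hk⟩ := hβ' y
      obtain ⟨x, hx⟩ := hrad n hn (α k)
      exact ⟨⟨(x, y), (hΓ _).2 ⟨n, hn, k, hx.symm, hk⟩⟩, rfl⟩
  refine ⟨(MulEquiv.ofBijective p₁ h₁).symm.trans (MulEquiv.ofBijective p₂ h₂), fun k => ?_⟩
  have : α k = MulEquiv.ofBijective p₁ h₁
      ⟨(α k, β k), (hΓ _).2 ⟨1, one_pos, k, by simp, by simp⟩⟩ := rfl
  rw [MulEquiv.trans_apply, this, MulEquiv.symm_apply_apply]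
  rfl

/-! ### Simple virtual endomorphisms -/

theorem VirtualEndomorphism.isSimple_iff {G : Type*} [Group G] (f : VirtualEndomorphism G) :
    f.IsSimple ↔ ∀ N : Subgroup G, N ≤ f.domain → N.Normal →
      (∀ x : f.domain, (x : G) ∈ N → f.toHom x ∈ N) → N = ⊥ := by
  simp [VirtualEndomorphism.IsSimple, VirtualEndomorphism.core, sSup_eq_bot]

/-- Otherwise the kernel of `f` contains a nontrivial central element `x` of the domain. Roots being
unique and the domain of finite index, `x` is central in `G`, and the cyclic subgroup it generates
lies in the core of `f`. -/
theorem VirtualEndomorphism.injective_of_isSimple {G : Type*} [Group G] [Group.IsNilpotent G]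
    [IsMulTorsionFree G] {f : VirtualEndomorphism G} (hf : f.IsSimple) :
    Function.Injective f.toHom := by
  rw [← MonoidHom.ker_eq_bot_iff]
  by_contra hker
  obtain ⟨x, hx, hxc, hx1⟩ := Subgroup.exists_mem_center_of_normal_ne_bot hker
  have hxG : (x : G) ∈ Subgroup.center G := by
    refine Subgroup.mem_center_iff.2 fun g => ?_
    obtain ⟨n, hn, -, hgn⟩ := Subgroup.exists_pow_mem_of_index_ne_zero f.finiteIndex.index_ne_zero g
    have hc : (x : G) * g ^ n = g ^ n * x :=
      congrArg Subtype.val (Subgroup.mem_center_iff.1 hxc ⟨g ^ n, hgn⟩).symm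
    have h1 : ((x : G) * g * (x : G)⁻¹) ^ n = g ^ n := by
      rw [conj_pow, hc, mul_inv_cancel_right]
    exact (mul_inv_eq_iff_eq_mul.1 (pow_left_injective hn.ne' h1)).symm
  have h := (f.isSimple_iff.1 hf) (Subgroup.zpowers (x : G))
    (Subgroup.zpowers_le.2 x.2)
    ⟨fun y hy g => by
      rwa [Subgroup.mem_center_iff.1 (Subgroup.zpowers_le.2 hxG hy) g, mul_inv_cancel_right]⟩ ?_
  · exact hx1 (Subtype.ext (Subgroup.zpowers_eq_bot.1 h))
  · rintro y ⟨j, hj⟩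
    have : y = x ^ j := Subtype.ext (by simpa using hj.symm)
    rw [this, map_zpow, MonoidHom.mem_ker.1 hx, one_zpow]
    exact one_mem _

/-! ### Contracting automorphisms of the completion -/

/-- The property of a subgroup `A` of `M` that corresponds to strong recurrent self-similarity when
`M` is the Malcev completion of `A`: every finite index subgroup of `A` contains `φ(A)` for some
automorphism `φ` of `M` such that no nontrivial subgroup `N` of `A ⊓ Z(M)` satisfies `N ≤ φ(N)`. The
map `φ` is the inverse of a virtual endomorphism, so `N ≤ φ(N)` says that `N` is contained in the
domain of that endomorphism and invariant under it. -/
def HasSimpleContractions {M : Type*} [Group M] (A : Subgroup M) : Prop :=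
  ∀ L ≤ A, L.relIndex A ≠ 0 → ∃ φ : M ≃* M, A.map φ.toMonoidHom ≤ L ∧
    ∀ N ≤ A, N ≤ Subgroup.center M → N ≤ N.map φ.toMonoidHom → N = ⊥

/-- The change of lattice: for finitely generated subgroups `A`, `B` of `M` with isolator `M`,
contracting automorphisms of `M` for `A` that shrink `A` far enough are contracting for `B`. -/
theorem HasSimpleContractions.of_commensurable {M : Type*} [Group M] [Group.IsNilpotent M]
    [IsMulTorsionFree M] {A B : Subgroup M} (hAfg : A.FG) (hBfg : B.FG)
    (hA : ∀ x : M, ∃ n, 0 < n ∧ x ^ n ∈ A) (hB : ∀ x : M, ∃ n, 0 < n ∧ x ^ n ∈ B)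
    (h : HasSimpleContractions A) : HasSimpleContractions B := by
  intro L hLB hL
  obtain ⟨m, hm, hmA⟩ := Subgroup.exists_forall_pow_mem_of_relIndex_ne_zero
    (Subgroup.relIndex_ne_zero_of_forall_exists_pow_mem hBfg fun x _ => hA x)
  have hD : (L ⊓ A).relIndex A ≠ 0 := by
    refine Subgroup.relIndex_ne_zero_of_forall_exists_pow_mem hAfg fun x hx => ?_
    obtain ⟨n, hn, hxn⟩ := hB x
    obtain ⟨k, hk, -, hxk⟩ := Subgroup.exists_pow_mem_of_relIndex_ne_zero hL hxn
    refine ⟨n * k, Nat.mul_pos hn hk, ?_, pow_mem hx _⟩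
    rw [pow_mul]
    exact hxk.1
  obtain ⟨H, hHD, hH, hroot⟩ := Subgroup.exists_finiteIndex_pow_mem_imp_mem
    (hAfg.of_relIndex_ne_zero inf_le_right hD) hm
  obtain ⟨φ, hφ, hsimple⟩ := h H (hHD.trans inf_le_right) (Subgroup.relIndex_ne_zero_trans hH hD)
  refine ⟨φ, ?_, fun N hNB hNc hNφ => ?_⟩
  · rintro _ ⟨b, hb, rfl⟩
    refine (hroot (φ b) ?_).1
    rw [← map_pow]
    exact hφ (Subgroup.mem_map_of_mem _ (hmA b hb))
  -- `P` consists of the `m`-th powers of the elements of `N`; it lies in `A`.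
  · let P : Subgroup M :=
      { carrier := {y | ∃ x ∈ N, x ^ m = y}
        one_mem' := ⟨1, one_mem _, one_pow _⟩
        mul_mem' := by
          rintro _ _ ⟨x, hx, rfl⟩ ⟨y, hy, rfl⟩
          exact ⟨x * y, mul_mem hx hy,
            (show Commute x y from Subgroup.mem_center_iff.1 (hNc hy) x).mul_pow m⟩
        inv_mem' := by
          rintro _ ⟨x, hx, rfl⟩
          exact ⟨x⁻¹, inv_mem hx, inv_pow x m⟩ }
    have hP : P = ⊥ := by
      refine hsimple P ?_ ?_ ?_
      · rintro _ ⟨x, hx, rfl⟩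
        exact hmA x (hNB hx)
      · rintro _ ⟨x, hx, rfl⟩
        exact pow_mem (hNc hx) m
      · rintro _ ⟨x, hx, rfl⟩
        obtain ⟨y, hy, rfl⟩ := hNφ hx
        exact ⟨y ^ m, ⟨y, hy, rfl⟩, map_pow _ _ _⟩
    refine (Subgroup.eq_bot_iff_forall _).2 fun x hx => ?_
    have hx1 : x ^ m = 1 ^ m := by
      rw [one_pow]
      exact (Subgroup.eq_bot_iff_forall _).1 hP _ ⟨x, hx, rfl⟩
    exact pow_left_injective hm.ne' hx1

/-! ### Virtual endomorphisms as automorphisms of the Malcev completion -/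

theorem IsMalcevCompletion.isMulTorsionFree {G M : Type*} [Group G] [Group M] {ι : G →* M}
    (hι : IsMalcevCompletion ι) : IsMulTorsionFree M :=
  have := hι.nilpotent
  hι.torsionFree.isMulTorsionFree

/-- The contracting automorphisms extend the inverses of the simple recurrent virtual endomorphisms
of `G`. -/
theorem IsMalcevCompletion.hasSimpleContractions_range {G M : Type*} [Group G] [Group M]
    {ι : G →* M} (hι : IsMalcevCompletion ι) (h : StronglyRecurrentSelfSimilar G) :
    HasSimpleContractions ι.range := by
  have := hι.nilpotent
  have := hι.isMulTorsionFree
  have : Group.IsNilpotent G := Group.nilpotent_of_mulEquiv (ι.ofInjective hι.injective).symm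
  have : IsMulTorsionFree G := hι.injective.isMulTorsionFree ι
  intro L hLA hL
  have hidx : (L.comap ι).FiniteIndex := ⟨by rwa [Subgroup.index_comap]⟩
  obtain ⟨f, hfL, hf, hrec⟩ := h _ hidx
  have hinj := f.injective_of_isSimple hf
  obtain ⟨φ, hφ⟩ := exists_mulEquiv_extending hι.radicable
    (α := ι.comp f.toHom) (β := ι.comp f.domain.subtype) (hι.injective.comp hinj)
    (hι.injective.comp f.domain.subtype_injective)
    (fun x => by
      obtain ⟨n, hn, g, hg⟩ := hι.exists_pow_mem x
      obtain ⟨k, rfl⟩ := hrec g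
      exact ⟨n, hn, k, hg⟩)
    (fun x => by
      obtain ⟨n, hn, g, hg⟩ := hι.exists_pow_mem x
      obtain ⟨k, hk, -, hgk⟩ :=
        Subgroup.exists_pow_mem_of_index_ne_zero f.finiteIndex.index_ne_zero g
      refine ⟨n * k, Nat.mul_pos hn hk, ⟨g ^ k, hgk⟩, ?_⟩
      simp [pow_mul, hg])
  replace hφ : ∀ k, φ (ι (f.toHom k)) = ι k := hφ
  refine ⟨φ, ?_, fun N hNA hNc hNφ => ?_⟩
  · rintro _ ⟨_, ⟨g, rfl⟩, rfl⟩
    obtain ⟨k, rfl⟩ := hrec g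
    exact (hφ k).symm ▸ hfL k.2
  · have h1 : N.comap ι = ⊥ := by
      refine f.isSimple_iff.1 hf _ (fun x hx => ?_) ⟨fun x hx g => ?_⟩ fun x hx => ?_
      · obtain ⟨n, hn, hnx⟩ := hNφ hx
        obtain ⟨y, rfl⟩ := hNA hn
        obtain ⟨k, rfl⟩ := hrec y
        rw [← hι.injective ((hφ k).symm.trans hnx)]
        exact k.2
      · rw [Subgroup.mem_comap, map_mul, map_mul, map_inv,
          Subgroup.mem_center_iff.1 (hNc hx) (ι g), mul_inv_cancel_right]
        exact hx
      · obtain ⟨n, hn, hnx⟩ := hNφ hx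
        have : n = ι (f.toHom x) := φ.injective (hnx.trans (hφ x).symm)
        rwa [Subgroup.mem_comap, ← this]
    rw [← Subgroup.map_comap_eq_self hNA, h1, Subgroup.map_bot]

/-- The virtual endomorphism defined by a contracting automorphism `φ` is `φ⁻¹`, restricted to the
elements of `G` that it maps into `G`. -/
theorem IsMalcevCompletion.stronglyRecurrentSelfSimilar {G M : Type*} [Group G] [Group M]
    [Group.FG G] {ι : G →* M} (hι : IsMalcevCompletion ι) (h : HasSimpleContractions ι.range) :
    StronglyRecurrentSelfSimilar G := by
  have := hι.nilpotent
  have := hι.isMulTorsionFree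
  have : Group.IsNilpotent G := Group.nilpotent_of_mulEquiv (ι.ofInjective hι.injective).symm
  intro H hH
  have hL : (H.map ι).relIndex ι.range ≠ 0 := by
    rw [← Subgroup.index_comap, Subgroup.comap_map_eq_self_of_injective hι.injective]
    exact hH.index_ne_zero
  obtain ⟨φ, hφ, hsimple⟩ := h (H.map ι) (Subgroup.map_le_range _ _) hL
  let ψ : G →* M := φ.symm.toMonoidHom.comp ι
  let K : Subgroup G := ι.range.comap ψ
  have hK : K.index ≠ 0 := Subgroup.index_ne_zero_of_forall_exists_pow_mem fun g => by
    obtain ⟨n, hn, hg⟩ := hι.exists_pow_mem (ψ g)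
    exact ⟨n, hn, by rwa [Subgroup.mem_comap, map_pow]⟩
  let e := ι.ofInjective hι.injective
  let f : VirtualEndomorphism G :=
    ⟨K, ⟨hK⟩, e.symm.toMonoidHom.comp ((ψ.comp K.subtype).codRestrict ι.range fun x => x.2)⟩
  have hf : ∀ x : K, φ (ι (f.toHom x)) = ι x := by
    intro x
    have h1 : ι (f.toHom x) = φ.symm (ι x) :=
      congrArg Subtype.val (e.apply_symm_apply ⟨ψ x, x.2⟩)
    rw [h1, MulEquiv.apply_symm_apply]
  refine ⟨f, fun x hx => ?_, ?_, fun g => ?_⟩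
  · have : ι x ∈ H.map ι := hφ ⟨ι (f.toHom ⟨x, hx⟩), ⟨_, rfl⟩, hf ⟨x, hx⟩⟩
    rwa [Subgroup.mem_map_iff_mem hι.injective] at this
  · refine f.isSimple_iff.2 fun N hNK hN hNf => ?_
    by_contra hNbot
    obtain ⟨x, hx, hxc, hx1⟩ := Subgroup.exists_mem_center_of_normal_ne_bot hNbot
    have hcenter : ∀ z ∈ Subgroup.center G, ι z ∈ Subgroup.center M := by
      intro z hz
      refine Subgroup.mem_center_iff.2 fun y => ?_
      obtain ⟨n, hn, g, hg⟩ := hι.exists_pow_mem y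
      have hc : ι z * y ^ n = y ^ n * ι z := by
        rw [← hg, ← map_mul, ← map_mul, Subgroup.mem_center_iff.1 hz g]
      have h1 : (ι z * y * (ι z)⁻¹) ^ n = y ^ n := by
        rw [conj_pow, hc, mul_inv_cancel_right]
      exact (mul_inv_eq_iff_eq_mul.1 (pow_left_injective hn.ne' h1)).symm
    have hbot : (N ⊓ Subgroup.center G).map ι = ⊥ := by
      refine hsimple _ (Subgroup.map_le_range _ _) ?_ ?_
      · rintro _ ⟨z, hz, rfl⟩
        exact hcenter z hz.2
      · rintro _ ⟨z, hz, rfl⟩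
        have hfz := hf ⟨z, hNK hz.1⟩
        refine ⟨_, ⟨f.toHom ⟨z, hNK hz.1⟩, ⟨hNf _ hz.1, ?_⟩, rfl⟩, hfz⟩
        refine Subgroup.mem_center_iff.2 fun g => hι.injective (φ.injective ?_)
        rw [map_mul, map_mul, map_mul, map_mul, hfz]
        exact Subgroup.mem_center_iff.1 (hcenter z hz.2) _
    rw [Subgroup.map_eq_bot_iff_of_injective _ hι.injective] at hbot
    exact hx1 ((Subgroup.eq_bot_iff_forall _).1 hbot x ⟨hx, hxc⟩)
  · obtain ⟨x, -, hx⟩ := hφ ⟨ι g, ⟨g, rfl⟩, rfl⟩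
    have hxg : ψ x = ι g := by
      change φ.symm (ι x) = ι g
      rw [hx]
      exact φ.symm_apply_apply _
    refine ⟨⟨x, g, hxg.symm⟩, hι.injective (φ.injective ?_)⟩
    rw [hf]
    exact hx

theorem IsMalcevCompletion.comp_mulEquiv {G M M' : Type*} [Group G] [Group M] [Group M']
    {ι : G →* M} (hι : IsMalcevCompletion ι) (e : M ≃* M') :
    IsMalcevCompletion (e.toMonoidHom.comp ι) where
  nilpotent := have := hι.nilpotent; Group.nilpotent_of_mulEquiv e
  torsionFree x hx := by
    have h := hι.torsionFree (e.symm x) (e.symm.toMonoidHom.isOfFinOrder hx)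
    simpa using h
  radicable n hn x := by
    obtain ⟨y, hy⟩ := hι.radicable n hn (e.symm x)
    exact ⟨e y, by rw [← map_pow, hy, e.apply_symm_apply]⟩
  injective := e.injective.comp hι.injective
  exists_pow_mem x := by
    obtain ⟨n, hn, g, hg⟩ := hι.exists_pow_mem (e.symm x)
    exact ⟨n, hn, g, by simp [hg]⟩

theorem StronglyRecurrentSelfSimilar.of_common_malcevCompletion {G₁ G₂ M : Type*} [Group G₁]
    [Group G₂] [Group M] [Group.FG G₁] [Group.FG G₂] {ι₁ : G₁ →* M} {ι₂ : G₂ →* M}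
    (h₁ : IsMalcevCompletion ι₁) (h₂ : IsMalcevCompletion ι₂)
    (h : StronglyRecurrentSelfSimilar G₁) : StronglyRecurrentSelfSimilar G₂ := by
  have := h₁.nilpotent
  have := h₁.isMulTorsionFree
  refine h₂.stronglyRecurrentSelfSimilar
    ((h₁.hasSimpleContractions_range h).of_commensurable ?_ ?_
      h₁.exists_pow_mem h₂.exists_pow_mem)
  · exact (Group.fg_iff_subgroup_fg _).1 inferInstance
  · exact (Group.fg_iff_subgroup_fg _).1 inferInstance

theorem theoremB (c : ℕ)
    {G₁ : Type*} [Group G₁] (hG₁ : IsTGroupOfClass c G₁)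
    {G₂ : Type*} [Group G₂] (hG₂ : IsTGroupOfClass c G₂)
    {M₁ : Type*} [Group M₁] (ι₁ : G₁ →* M₁) (hM₁ : IsMalcevCompletion ι₁)
    {M₂ : Type*} [Group M₂] (ι₂ : G₂ →* M₂) (hM₂ : IsMalcevCompletion ι₂)
    (hiso : Nonempty (M₁ ≃* M₂)) :
    StronglyRecurrentSelfSimilar G₁ ↔ StronglyRecurrentSelfSimilar G₂ := by
  obtain ⟨e⟩ := hiso
  have := hG₁.fg
  have := hG₂.fg
  have h := hM₁.comp_mulEquiv e
  exact ⟨.of_common_malcevCompletion h hM₂, .of_common_malcevCompletion hM₂ h⟩
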